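/- Let $\mathfrak A$ be a $C^*$-algebra, $H$ a Hilbert $\mathfrak A$-module, and $\mathcal L(E,F)$ the space of adjointable operators between Hilbert $\mathfrak A$-modules ($\mathcal L(E)=\mathcal L(E,E)$). Write $\mathcal R$ and $\mathcal N$ for range and null space, and $P_M$ for the projection onto an orthogonally complemented closed submodule $M$. Let $P\in\mathcal L(H)$ be a projection with $P\neq 0$, $P\ne I$, and let $Q\in\mathcal L(H)$ be an idempotent such that $(P,Q)$ is a quasi-projection pair, i.e. $$PQ^*P=PQP,\quad PQ^*(I-P)=-PQ(I-P),\quad (I-P)Q^*(I-P)=(I-P)Q(I-P).$$ Assume that the pair is harmonious, i.e. $\overline{\mathcal R(PQ(I-P))}$ and $\overline{\mathcal R((I-P)QP)}$ are both orthogonally complemented in $H$. Let $U_P:H\to\mathcal R(P)\oplus\mathcal N(P)$ be the unitary $U_Ph=(Ph,(I-P)h)^T$, and let $$U_PQU_P^*=\begin{pmatrix}A&-\ell(A)U^*\\ U\ell(A)&U(I_{\mathcal R(P)}-A)U^*+Q_0\end{pmatrix},\qquad \ell(A)=(A^2-A)^{1/2},$$ be the canonical block representation of $Q$ induced by $P$;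 that is, $A\in\mathcal L(\mathcal R(P))$ is self-adjoint with $A^2-A\ge 0$, $U\in\mathcal L(\mathcal R(P),\mathcal N(P))$ is a partial isometry, and $Q_0\in\mathcal L(\mathcal N(P))$ is a projection, with $\mathcal R(U^*)=\overline{\mathcal R(A^2-A)}$ and $U^*Q_0=0$. Then $\sigma(A)\subseteq(0,1)^c=(-\infty,0]\cup[1,\infty)$, the operator $2A-I_{\mathcal R(P)}$ is invertible, and $\mathcal R(Q)$ is orthogonally complemented in $H$. Put $$B=A(2A-I_{\mathcal R(P)})^{-1},\qquad U_1=Uf(A),$$ where $f:(0,1)^c\to\mathbb R$ is the continuous function with $f=1$ on $[1,\infty)$ and $f=-1$ on $(-\infty,0]$. Then $B$ is a positive contraction, $U_1$ is a partial isometry, $$\mathcal R(U_1^*)=\overline{\mathcal R\big(B(I_{\mathcal R(P)}-B)\big)},\qquad U_1^*Q_0=0,$$ and $$U_PP_{\mathcal R(Q)}U_P^*=\begin{pmatrix}B&B^{1/2}(I_{\mathcal R(P)}-B)^{1/2}U_1^*\\ U_1B^{1/2}(I_{\mathcal R(P)}-B)^{1/2}&U_1(I_{\mathcal R(P)}-B)U_1^*+Q_0\end{pmatrix}.$$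 -/

import Mathlib

open scoped InnerProductSpace WithCStarModule

namespace HilbertCStar

/-! ### Adjointable operators between Hilbert C⋆-modules -/

/-- The space `𝓛(E, F)` of adjointable operators between Hilbert `𝔄`-modules. The adjoint is stored
as data; it is uniquely determined (see `Adjointable.ext`). Adjointable operators are automatically
`𝔄`-linear (see `Adjointable.map_action`). -/
structure Adjointable (𝔄 E F : Type*) [NonUnitalCStarAlgebra 𝔄] [PartialOrder 𝔄]
    [StarOrderedRing 𝔄]
    [NormedAddCommGroup E] [NormedSpace ℂ E] [SMul 𝔄 E] [CStarModule 𝔄 E]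
    [NormedAddCommGroup F] [NormedSpace ℂ F] [SMul 𝔄 F] [CStarModule 𝔄 F] where
  toCLM : E →L[ℂ] F
  adjCLM : F →L[ℂ] E
  inner_adj : ∀ (x : E) (y : F), ⟪toCLM x, y⟫_𝔄 = ⟪x, adjCLM y⟫_𝔄

section Basic

variable {𝔄 E F G : Type*} [NonUnitalCStarAlgebra 𝔄] [PartialOrder 𝔄] [StarOrderedRing 𝔄]
variable [NormedAddCommGroup E] [NormedSpace ℂ E] [SMul 𝔄 E] [CStarModule 𝔄 E]
variable [NormedAddCommGroup F] [NormedSpace ℂ F] [SMul 𝔄 F] [CStarModule 𝔄 F]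
variable [NormedAddCommGroup G] [NormedSpace ℂ G] [SMul 𝔄 G] [CStarModule 𝔄 G]

theorem eq_of_inner_right (𝔄 : Type*) {E : Type*} [NonUnitalCStarAlgebra 𝔄] [PartialOrder 𝔄]
    [StarOrderedRing 𝔄] [NormedAddCommGroup E] [NormedSpace ℂ E] [SMul 𝔄 E] [CStarModule 𝔄 E]
    {y z : E} (h : ∀ x : E, ⟪x, y⟫_𝔄 = ⟪x, z⟫_𝔄) : y = z := by
  have h1 : ⟪y - z, y - z⟫_𝔄 = 0 := by
    rw [CStarModule.inner_sub_right, h, sub_self]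
  exact sub_eq_zero.mp (CStarModule.inner_self.mp h1)

namespace Adjointable

instance : CoeFun (Adjointable 𝔄 E F) (fun _ => E → F) := ⟨fun T => T.toCLM⟩

@[ext]
theorem ext {S T : Adjointable 𝔄 E F} (h : ∀ x, S x = T x) : S = T := by
  have h1 : S.toCLM = T.toCLM := ContinuousLinearMap.ext h
  have h2 : S.adjCLM = T.adjCLM := by
    ext y
    refine eq_of_inner_right 𝔄 fun x => ?_
    rw [← S.inner_adj, ← T.inner_adj, h1]
  cases S; cases T; simp_all

theorem toCLM_injective : Function.Injective (toCLM : Adjointable 𝔄 E F → (E →L[ℂ] F)) :=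
  fun _ _ h => ext fun x => by rw [h]

/-- The adjoint `T⋆ ∈ 𝓛(F, E)` of `T ∈ 𝓛(E, F)`. -/
def adjoint (T : Adjointable 𝔄 E F) : Adjointable 𝔄 F E where
  toCLM := T.adjCLM
  adjCLM := T.toCLM
  inner_adj x y := by
    rw [← CStarModule.star_inner, ← T.inner_adj, CStarModule.star_inner]

theorem inner_left (T : Adjointable 𝔄 E F) (x : E) (y : F) : ⟪T x, y⟫_𝔄 = ⟪x, T.adjoint y⟫_𝔄 :=
  T.inner_adj x y

theorem map_action (T : Adjointable 𝔄 E F) (a : 𝔄) (x : E) : T (a • x) = a • T x := by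
  refine eq_of_inner_right 𝔄 fun y => ?_
  rw [CStarModule.inner_op_smul_right]
  have h : ∀ u : E, ⟪y, T u⟫_𝔄 = ⟪T.adjoint y, u⟫_𝔄 := fun u => T.adjoint.inner_left y u |>.symm
  rw [h, h, CStarModule.inner_op_smul_right]

/-- Composition of adjointable operators. -/
def comp (S : Adjointable 𝔄 F G) (T : Adjointable 𝔄 E F) : Adjointable 𝔄 E G where
  toCLM := S.toCLM.comp T.toCLM
  adjCLM := T.adjCLM.comp S.adjCLM
  inner_adj x y := by simp [S.inner_adj, T.inner_adj]

instance : Zero (Adjointable 𝔄 E F) := ⟨⟨0, 0, by simp⟩⟩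
instance : Add (Adjointable 𝔄 E F) :=
  ⟨fun S T => ⟨S.toCLM + T.toCLM, S.adjCLM + T.adjCLM, by simp [S.inner_adj, T.inner_adj]⟩⟩
instance : Neg (Adjointable 𝔄 E F) := ⟨fun S => ⟨-S.toCLM, -S.adjCLM, by simp [S.inner_adj]⟩⟩
instance : Sub (Adjointable 𝔄 E F) :=
  ⟨fun S T => ⟨S.toCLM - T.toCLM, S.adjCLM - T.adjCLM, by simp [S.inner_adj, T.inner_adj]⟩⟩
instance : SMul ℂ (Adjointable 𝔄 E F) :=
  ⟨fun c S => ⟨c • S.toCLM, star c • S.adjCLM, by simp [S.inner_adj]⟩⟩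

@[simp] theorem zero_toCLM : (0 : Adjointable 𝔄 E F).toCLM = 0 := rfl
@[simp] theorem add_toCLM (S T : Adjointable 𝔄 E F) : (S + T).toCLM = S.toCLM + T.toCLM := rfl
@[simp] theorem neg_toCLM (S : Adjointable 𝔄 E F) : (-S).toCLM = -S.toCLM := rfl
@[simp] theorem sub_toCLM (S T : Adjointable 𝔄 E F) : (S - T).toCLM = S.toCLM - T.toCLM := rfl
@[simp] theorem smul_toCLM (c : ℂ) (S : Adjointable 𝔄 E F) : (c • S).toCLM = c • S.toCLM := rfl
@[simp] theorem comp_apply (S : Adjointable 𝔄 F G) (T : Adjointable 𝔄 E F) (x : E) :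
    (S.comp T) x = S (T x) := rfl

instance : AddCommGroup (Adjointable 𝔄 E F) where
  add_assoc _ _ _ := by ext; simp [add_assoc]
  zero_add _ := by ext; simp
  add_zero _ := by ext; simp
  add_comm _ _ := by ext; simp [add_comm]
  neg_add_cancel _ := by ext; simp
  sub_eq_add_neg _ _ := by ext; simp [sub_eq_add_neg]
  nsmul := nsmulRec
  zsmul := zsmulRec

instance : Module ℂ (Adjointable 𝔄 E F) where
  one_smul _ := by ext; simp
  mul_smul _ _ _ := by ext; simp [mul_smul]
  smul_zero _ := by ext; simp
  smul_add _ _ _ := by ext; simp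
  add_smul _ _ _ := by ext; simp [add_smul]
  zero_smul _ := by ext; simp

/-! ### The C⋆-algebra `𝓛(E)` -/

instance : One (Adjointable 𝔄 E E) :=
  ⟨⟨ContinuousLinearMap.id ℂ E, ContinuousLinearMap.id ℂ E, by simp⟩⟩
instance : Mul (Adjointable 𝔄 E E) := ⟨fun S T => S.comp T⟩
instance : Star (Adjointable 𝔄 E E) := ⟨fun T => T.adjoint⟩

@[simp] theorem one_toCLM : (1 : Adjointable 𝔄 E E).toCLM = 1 := rfl
@[simp] theorem mul_toCLM (S T : Adjointable 𝔄 E E) : (S * T).toCLM = S.toCLM * T.toCLM := rfl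
@[simp] theorem star_adjCLM (T : Adjointable 𝔄 E E) : (star T).adjCLM = T.toCLM := rfl
theorem star_eq_adjoint (T : Adjointable 𝔄 E E) : star T = T.adjoint := rfl

theorem inner_star_right (T : Adjointable 𝔄 E E) (x y : E) : ⟪x, (star T) y⟫_𝔄 = ⟪T x, y⟫_𝔄 :=
  (T.inner_adj x y).symm

instance : Ring (Adjointable 𝔄 E E) where
  mul_assoc _ _ _ := by ext; simp
  one_mul _ := by ext; simp
  mul_one _ := by ext; simp
  left_distrib _ _ _ := by ext; simp
  right_distrib _ _ _ := by ext; simp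
  zero_mul _ := by ext; simp
  mul_zero _ := by ext; simp
  neg_add_cancel := neg_add_cancel
  zsmul := zsmulRec
  nsmul := nsmulRec
  sub_eq_add_neg := sub_eq_add_neg

instance : StarRing (Adjointable 𝔄 E E) where
  star_involutive _ := rfl
  star_mul _ _ := ext fun _ => rfl
  star_add _ _ := ext fun _ => rfl

/-- The forgetful ring homomorphism from `𝓛(E)` to the bounded operators on `E`. -/
def toCLMHom : Adjointable 𝔄 E E →+* (E →L[ℂ] E) where
  toFun := toCLM
  map_one' := rfl
  map_mul' _ _ := rfl
  map_zero' := rfl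
  map_add' _ _ := rfl

/-- `𝓛(E)` carries the operator norm. -/
noncomputable instance : NormedRing (Adjointable 𝔄 E E) :=
  NormedRing.induced _ _ (toCLMHom (𝔄 := 𝔄) (E := E)) toCLM_injective

theorem norm_def (T : Adjointable 𝔄 E E) : ‖T‖ = ‖T.toCLM‖ := rfl

noncomputable instance : NormedAlgebra ℂ (Adjointable 𝔄 E E) where
  algebraMap :=
    { toFun := fun c => c • 1
      map_one' := one_smul _ _
      map_mul' := fun a b => by ext; simp [mul_smul, smul_comm a b]
      map_zero' := zero_smul _ _
      map_add' := fun a b => add_smul _ _ _ }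
  commutes' _ _ := by ext; simp
  smul_def' _ _ := by ext; simp
  norm_smul_le c T := by
    rw [norm_def, norm_def, smul_toCLM]
    exact norm_smul_le c T.toCLM

instance : StarModule ℂ (Adjointable 𝔄 E E) where
  star_smul _ _ := ext fun _ => rfl

instance : CStarRing (Adjointable 𝔄 E E) where
  norm_mul_self_le T := by
    have h : ‖T.toCLM‖ ≤ √‖star T * T‖ := by
      refine ContinuousLinearMap.opNorm_le_bound _ (Real.sqrt_nonneg _) fun x => ?_
      rw [← Real.sqrt_sq (norm_nonneg x), ← Real.sqrt_mul (norm_nonneg _)]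
      refine Real.le_sqrt_of_sq_le ?_
      rw [CStarModule.norm_sq_eq 𝔄, T.inner_adj]
      calc _ ≤ ‖x‖ * ‖(star T * T).toCLM x‖ := CStarModule.norm_inner_le E
        _ ≤ ‖x‖ * (‖(star T * T).toCLM‖ * ‖x‖) := by
            gcongr; exact ContinuousLinearMap.le_opNorm _ _
        _ = ‖star T * T‖ * ‖x‖ ^ 2 := by rw [norm_def]; ring
    calc ‖T‖ * ‖T‖ ≤ √‖star T * T‖ * √‖star T * T‖ := by
          gcongr <;> exact h
      _ = ‖star T * T‖ := Real.mul_self_sqrt (norm_nonneg _)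

instance [CompleteSpace E] : CompleteSpace (Adjointable 𝔄 E E) := by
  refine Metric.complete_of_cauchySeq_tendsto fun u hu => ?_
  have hd : ∀ S T : Adjointable 𝔄 E E, dist S.toCLM T.toCLM = dist S T := fun S T => by
    rw [dist_eq_norm, dist_eq_norm, norm_def]; rfl
  have hd' : ∀ S T : Adjointable 𝔄 E E, dist S.adjCLM T.adjCLM = dist S T := fun S T => by
    have h1 := hd (star S) (star T)
    rw [dist_eq_norm (star S), ← star_sub, norm_star, ← dist_eq_norm] at h1
    exact h1
  have h1 : CauchySeq fun n => (u n).toCLM := by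
    rw [Metric.cauchySeq_iff] at hu ⊢
    simpa only [hd] using hu
  have h2 : CauchySeq fun n => (u n).adjCLM := by
    rw [Metric.cauchySeq_iff] at hu ⊢
    simpa only [hd'] using hu
  obtain ⟨S, hS⟩ := cauchySeq_tendsto_of_complete h1
  obtain ⟨R, hR⟩ := cauchySeq_tendsto_of_complete h2
  refine ⟨⟨S, R, fun x y => ?_⟩, ?_⟩
  · have hSx := ((ContinuousLinearMap.apply ℂ E x).continuous.tendsto S).comp hS
    have hRy := ((ContinuousLinearMap.apply ℂ E y).continuous.tendsto R).comp hR
    have l1 := ((CStarModule.continuous_inner (A := 𝔄) (E := E)).tendsto (S x, y)).comp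
      (hSx.prodMk_nhds tendsto_const_nhds)
    have l2 := ((CStarModule.continuous_inner (A := 𝔄) (E := E)).tendsto (x, R y)).comp
      ((tendsto_const_nhds (x := x)).prodMk_nhds hRy)
    refine tendsto_nhds_unique l1 (l2.congr fun n => ?_)
    exact ((u n).inner_adj x y).symm
  · rw [tendsto_iff_dist_tendsto_zero] at hS ⊢
    exact hS.congr fun n => hd (u n) ⟨S, R, _⟩

noncomputable instance [CompleteSpace E] : CStarAlgebra (Adjointable 𝔄 E E) where

/-- `S ≤ T` in `𝓛(E)` means that `T - S` is a positive element of this C⋆-algebra. -/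
noncomputable instance [CompleteSpace E] : PartialOrder (Adjointable 𝔄 E E) :=
  CStarAlgebra.spectralOrder _

instance [CompleteSpace E] : StarOrderedRing (Adjointable 𝔄 E E) :=
  CStarAlgebra.spectralOrderedRing _

/-- `U ∈ 𝓛(E, F)` is a partial isometry if `U U⋆ U = U`. -/
def IsPartialIsometry (U : Adjointable 𝔄 E F) : Prop := (U.comp U.adjoint).comp U = U

end Adjointable

/-! ### Closed submodules -/

/-- A closed `𝔄`-submodule of a Hilbert `𝔄`-module. -/
structure ClosedSubmod (𝔄 E : Type*) [NonUnitalCStarAlgebra 𝔄] [PartialOrder 𝔄]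
    [StarOrderedRing 𝔄] [NormedAddCommGroup E] [NormedSpace ℂ E] [SMul 𝔄 E] [CStarModule 𝔄 E] where
  toSubmodule : Submodule ℂ E
  action_mem : ∀ (a : 𝔄) {x : E}, x ∈ toSubmodule → a • x ∈ toSubmodule
  isClosed : IsClosed (toSubmodule : Set E)

namespace ClosedSubmod

instance : CoeSort (ClosedSubmod 𝔄 E) (Type _) := ⟨fun M => M.toSubmodule⟩

variable (M : ClosedSubmod 𝔄 E)

instance : SMul 𝔄 M := ⟨fun a x => ⟨a • (x : E), M.action_mem a x.2⟩⟩

instance : CStarModule 𝔄 M where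
  inner x y := ⟪(x : E), (y : E)⟫_𝔄
  inner_add_right := CStarModule.inner_add_right
  inner_self_nonneg := CStarModule.inner_self_nonneg
  inner_self := CStarModule.inner_self.trans (by simp)
  inner_op_smul_right := CStarModule.inner_op_smul_right
  inner_smul_right_complex := CStarModule.inner_smul_right_complex
  star_inner x y := CStarModule.star_inner _ _
  norm_eq_sqrt_norm_inner_self x := CStarModule.norm_eq_sqrt_norm_inner_self (A := 𝔄) (x : E)

instance [CompleteSpace E] : CompleteSpace M := M.isClosed.completeSpace_coe

theorem inner_coe (x y : M) : ⟪x, y⟫_𝔄 = ⟪(x : E), (y : E)⟫_𝔄 := rfl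

/-- The closure of the range of an adjointable operator. -/
def closureRange (T : Adjointable 𝔄 E F) : ClosedSubmod 𝔄 F where
  toSubmodule := T.toCLM.range.topologicalClosure
  action_mem a x hx := by
    have hc : Continuous fun y : F => a • y := by
      have hadd : ∀ y z : F, a • (y + z) = a • y + a • z := fun y z =>
        eq_of_inner_right 𝔄 fun w => by simp [mul_add]
      have hsm : ∀ (c : ℂ) (z : F), a • (c • z) = c • (a • z) := fun c z =>
        eq_of_inner_right 𝔄 fun w => by simp [mul_smul_comm]
      let L : F →ₗ[ℂ] F := ⟨⟨fun y => a • y, hadd⟩, hsm⟩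
      refine AddMonoidHomClass.continuous_of_bound L ‖a‖ fun y => ?_
      refine abs_le_of_sq_le_sq' ?_ (by positivity) |>.2
      rw [CStarModule.norm_sq_eq 𝔄, mul_pow, CStarModule.norm_sq_eq 𝔄 (x := y)]
      change ‖⟪a • y, a • y⟫_𝔄‖ ≤ _
      rw [CStarModule.inner_op_smul_right, CStarModule.inner_op_smul_left]
      calc _ ≤ ‖a‖ * (‖⟪y, y⟫_𝔄‖ * ‖star a‖) :=
            (norm_mul_le _ _).trans (by gcongr; exact norm_mul_le _ _)
        _ = _ := by rw [norm_star]; ring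
    refine map_mem_closure hc hx fun y hy => ?_
    obtain ⟨z, rfl⟩ := hy
    exact ⟨a • z, T.map_action a z⟩
  isClosed := Submodule.isClosed_topologicalClosure _

/-- The range `𝓡(P)` of an idempotent `P ∈ 𝓛(E)`. -/
def range (P : Adjointable 𝔄 E E) (hP : IsIdempotentElem P) : ClosedSubmod 𝔄 E where
  toSubmodule := P.toCLM.range
  action_mem a x hx := by
    obtain ⟨z, rfl⟩ := hx
    exact ⟨a • z, P.map_action a z⟩
  isClosed := by
    have h : (P.toCLM.range : Set E) = {x | P x = x} := by
      ext x
      constructor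
      · rintro ⟨z, rfl⟩
        exact congrArg (fun T : Adjointable 𝔄 E E => T z) hP
      · intro hx
        exact ⟨x, hx⟩
    rw [h]
    exact isClosed_eq P.toCLM.continuous continuous_id

/-- The null space `𝓝(P)` of an operator. -/
def ker (P : Adjointable 𝔄 E F) : ClosedSubmod 𝔄 E where
  toSubmodule := P.toCLM.ker
  action_mem a x hx := by
    have hx' : P x = 0 := hx
    change P (a • x) = 0
    rw [P.map_action, hx']
    exact eq_of_inner_right 𝔄 fun w => by simp
  isClosed := P.toCLM.isClosed_ker

/-- Membership in the orthogonal complement `M^⊥`. -/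
def IsOrthogonalTo (x : E) : Prop := ∀ y ∈ M.toSubmodule, ⟪x, y⟫_𝔄 = 0

/-- `M` is orthogonally complemented in `E`: `E = M + M^⊥`. -/
def IsOrthogonallyComplemented : Prop :=
  ∀ x : E, ∃ y ∈ M.toSubmodule, ∃ z : E, M.IsOrthogonalTo z ∧ x = y + z

variable {M}

theorem decomp_unique {y y' z z' : E} (hy : y ∈ M.toSubmodule) (hy' : y' ∈ M.toSubmodule)
    (hz : M.IsOrthogonalTo z) (hz' : M.IsOrthogonalTo z') (h : y + z = y' + z') : y = y' := by
  have h1 : y - y' = z' - z := by rw [sub_eq_sub_iff_add_eq_add, h, add_comm]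
  have h2 : ⟪y - y', y - y'⟫_𝔄 = 0 := by
    nth_rewrite 1 [h1]
    rw [CStarModule.inner_sub_left, hz _ (M.toSubmodule.sub_mem hy hy'),
      hz' _ (M.toSubmodule.sub_mem hy hy'), sub_zero]
  exact sub_eq_zero.mp (CStarModule.inner_self.mp h2)

/-- The component in `M` of a vector of `E = M + M^⊥`. -/
noncomputable def component (hM : M.IsOrthogonallyComplemented) (x : E) : E := (hM x).choose

theorem component_mem (hM : M.IsOrthogonallyComplemented) (x : E) :
    component hM x ∈ M.toSubmodule := (hM x).choose_spec.1

theorem sub_component (hM : M.IsOrthogonallyComplemented) (x : E) :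
    M.IsOrthogonalTo (x - component hM x) := by
  obtain ⟨z, hz, h⟩ := (hM x).choose_spec.2
  have h' : x - component hM x = z := sub_eq_of_eq_add' h
  rwa [h']

theorem component_eq (hM : M.IsOrthogonallyComplemented) {x y : E} (hy : y ∈ M.toSubmodule)
    (hz : M.IsOrthogonalTo (x - y)) : component hM x = y :=
  decomp_unique (component_mem hM x) hy (sub_component hM x) hz (by simp)

theorem inner_component (hM : M.IsOrthogonallyComplemented) (x y : E) :
    ⟪component hM x, y⟫_𝔄 = ⟪x, component hM y⟫_𝔄 := by
  have h1 : ⟪x - component hM x, component hM y⟫_𝔄 = 0 :=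
    sub_component hM x _ (component_mem hM y)
  have h2 : ⟪component hM x, y - component hM y⟫_𝔄 = 0 := by
    rw [← CStarModule.star_inner, sub_component hM y _ (component_mem hM x), star_zero]
  rw [CStarModule.inner_sub_left, sub_eq_zero] at h1
  rw [CStarModule.inner_sub_right, sub_eq_zero] at h2
  rw [h1, h2]

/-- `component` as a bounded linear operator. -/
noncomputable def componentCLM (hM : M.IsOrthogonallyComplemented) : E →L[ℂ] E :=
  LinearMap.mkContinuous
    { toFun := component hM
      map_add' := fun x y => eq_of_inner_right 𝔄 fun w => by
        simp only [CStarModule.inner_add_right, ← inner_component]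
      map_smul' := fun c x => eq_of_inner_right 𝔄 fun w => by
        simp only [CStarModule.inner_smul_right_complex, ← inner_component, RingHom.id_apply] }
    1 fun x => by
      change ‖component hM x‖ ≤ 1 * ‖x‖
      rcases (norm_nonneg (component hM x)).eq_or_lt with h | h
      · rw [← h]; positivity
      · refine le_of_mul_le_mul_left ?_ h
        have h1 : component hM (component hM x) = component hM x :=
          component_eq hM (component_mem hM x) fun y _ => by simp
        calc ‖component hM x‖ * ‖component hM x‖ = ‖⟪component hM x, x⟫_𝔄‖ := by
              rw [← sq, CStarModule.norm_sq_eq 𝔄, ← inner_component, h1]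
          _ ≤ ‖component hM x‖ * ‖x‖ := CStarModule.norm_inner_le E
          _ = _ := by ring

/-- The projection `P_M ∈ 𝓛(E)` onto an orthogonally complemented closed submodule `M`, sending
`y + z` with `y ∈ M` and `z ∈ M^⊥` to `y`. -/
noncomputable def proj (M : ClosedSubmod 𝔄 E) (hM : M.IsOrthogonallyComplemented) :
    Adjointable 𝔄 E E where
  toCLM := componentCLM hM
  adjCLM := componentCLM hM
  inner_adj := inner_component hM

end ClosedSubmod

/-! ### Direct sums and block matrices -/

namespace Adjointable

/-- The operator on the Hilbert `𝔄`-module `E ⊕ F` with block matrix `[[a, b], [c, d]]`. -/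
noncomputable def block (a : Adjointable 𝔄 E E) (b : Adjointable 𝔄 F E) (c : Adjointable 𝔄 E F)
    (d : Adjointable 𝔄 F F) : Adjointable 𝔄 C⋆ᵐᵒᵈ(𝔄, E × F) C⋆ᵐᵒᵈ(𝔄, E × F) where
  toCLM := ((WithCStarModule.equivL ℂ (A := 𝔄) (E := E × F)).symm : (E × F) →L[ℂ] _) ∘L
    ((a.toCLM.coprod b.toCLM).prod (c.toCLM.coprod d.toCLM)) ∘L
    ((WithCStarModule.equivL ℂ (A := 𝔄) (E := E × F)) : _ →L[ℂ] (E × F))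
  adjCLM := ((WithCStarModule.equivL ℂ (A := 𝔄) (E := E × F)).symm : (E × F) →L[ℂ] _) ∘L
    ((a.adjCLM.coprod c.adjCLM).prod (b.adjCLM.coprod d.adjCLM)) ∘L
    ((WithCStarModule.equivL ℂ (A := 𝔄) (E := E × F)) : _ →L[ℂ] (E × F))
  inner_adj x y := by
    have key : ⟪a x.1 + b x.2, y.1⟫_𝔄 + ⟪c x.1 + d x.2, y.2⟫_𝔄 =
        ⟪x.1, a.adjCLM y.1 + c.adjCLM y.2⟫_𝔄 + ⟪x.2, b.adjCLM y.1 + d.adjCLM y.2⟫_𝔄 := by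
      simp only [CStarModule.inner_add_left, CStarModule.inner_add_right, inner_adj]
      abel
    exact key

theorem block_apply (a : Adjointable 𝔄 E E) (b : Adjointable 𝔄 F E) (c : Adjointable 𝔄 E F)
    (d : Adjointable 𝔄 F F) (x : C⋆ᵐᵒᵈ(𝔄, E × F)) :
    (block a b c d) x = (WithCStarModule.equiv 𝔄 (E × F)).symm
      (a x.1 + b x.2, c x.1 + d x.2) := rfl

end Adjointable

/-- The unitary operator `U_P : H → 𝓡(P) ⊕ 𝓝(P)`, `h ↦ (P h, (I - P) h)`, induced by a projection
`P ∈ 𝓛(H)`; its adjoint is `(h₁, h₂) ↦ h₁ + h₂`. -/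
noncomputable def unitaryOf (P : Adjointable 𝔄 E E) (hP : IsStarProjection P) :
    Adjointable 𝔄 E
      C⋆ᵐᵒᵈ(𝔄, ClosedSubmod.range P hP.isIdempotentElem × ClosedSubmod.ker P) where
  toCLM := ((WithCStarModule.equivL ℂ (A := 𝔄)
      (E := ClosedSubmod.range P hP.isIdempotentElem × ClosedSubmod.ker P)).symm :
        _ →L[ℂ] C⋆ᵐᵒᵈ(𝔄, _)) ∘L
    ((P.toCLM.codRestrict (ClosedSubmod.range P hP.isIdempotentElem).toSubmodule
        fun x => ⟨x, rfl⟩).prod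
      ((1 - P).toCLM.codRestrict (ClosedSubmod.ker P).toSubmodule fun x => by
        have h := congrArg (fun T : Adjointable 𝔄 E E => T x) hP.isIdempotentElem.mul_one_sub_self
        exact h))
  adjCLM := ((ClosedSubmod.range P hP.isIdempotentElem).toSubmodule.subtypeL.coprod
      (ClosedSubmod.ker P).toSubmodule.subtypeL) ∘L
    ((WithCStarModule.equivL ℂ (A := 𝔄)
      (E := ClosedSubmod.range P hP.isIdempotentElem × ClosedSubmod.ker P)) : _ →L[ℂ] _)
  inner_adj x y := by
    have hs : ∀ u v : E, ⟪P u, v⟫_𝔄 = ⟪u, P v⟫_𝔄 := fun u v => by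
      have h := P.inner_star_right u v
      rw [hP.isSelfAdjoint.star_eq] at h
      exact h.symm
    obtain ⟨w, hw⟩ := y.1.2
    have h1 : P (y.1 : E) = y.1 := by
      rw [← hw]
      exact congrArg (fun T : Adjointable 𝔄 E E => T w) hP.isIdempotentElem
    have h2 : P (y.2 : E) = 0 := y.2.2
    have key : ⟪P x, (y.1 : E)⟫_𝔄 + ⟪x - P x, (y.2 : E)⟫_𝔄 = ⟪x, (y.1 : E) + (y.2 : E)⟫_𝔄 := by
      rw [CStarModule.inner_sub_left, hs, hs, h1, h2, CStarModule.inner_zero_right, sub_zero,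
        CStarModule.inner_add_right]
    exact key

/-! ### Harmonious quasi-projection pairs and the canonical representation -/

/-- `(P, Q)` is a quasi-projection pair: `P` is a projection, `Q` is an idempotent, and
`P Q⋆ P = P Q P`, `P Q⋆ (I-P) = -P Q (I-P)`, `(I-P) Q⋆ (I-P) = (I-P) Q (I-P)`. -/
structure IsQuasiProjectionPair (P Q : Adjointable 𝔄 E E) : Prop where
  isStarProjection : IsStarProjection P
  isIdempotentElem : IsIdempotentElem Q
  corner₁₁ : P * star Q * P = P * Q * P
  corner₁₂ : P * star Q * (1 - P) = -(P * Q * (1 - P))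
  corner₂₂ : (1 - P) * star Q * (1 - P) = (1 - P) * Q * (1 - P)

/-- A quasi-projection pair is harmonious if the closures of the ranges of `P Q (I-P)` and
`(I-P) Q P` are both orthogonally complemented. -/
structure IsHarmonious (P Q : Adjointable 𝔄 E E) : Prop extends IsQuasiProjectionPair P Q where
  compl₅ : (ClosedSubmod.closureRange (P * Q * (1 - P))).IsOrthogonallyComplemented
  compl₆ : (ClosedSubmod.closureRange ((1 - P) * Q * P)).IsOrthogonallyComplemented

/-- `A`, `U`, `Q₀` are the data of the canonical `2 × 2` block matrix representation of `Q` induced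
by the projection `P`:
`U_P Q U_P⋆ = [[A, -ℓ(A) U⋆], [U ℓ(A), U (I - A) U⋆ + Q₀]]` with `ℓ(A) = (A² - A)^{1/2}`. -/
structure IsCanonicalRep [CompleteSpace E] (P : Adjointable 𝔄 E E) (hP : IsStarProjection P)
    (Q : Adjointable 𝔄 E E)
    (A : Adjointable 𝔄 (ClosedSubmod.range P hP.isIdempotentElem)
      (ClosedSubmod.range P hP.isIdempotentElem))
    (U : Adjointable 𝔄 (ClosedSubmod.range P hP.isIdempotentElem) (ClosedSubmod.ker P))
    (Q₀ : Adjointable 𝔄 (ClosedSubmod.ker P) (ClosedSubmod.ker P)) : Prop where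
  isSelfAdjoint : IsSelfAdjoint A
  nonneg : 0 ≤ A ^ 2 - A
  isPartialIsometry : U.IsPartialIsometry
  isStarProjection : IsStarProjection Q₀
  range_adjoint : Set.range U.adjoint = closure (Set.range (A ^ 2 - A).toCLM)
  adjoint_comp : U.adjoint.comp Q₀ = 0
  block_eq : ((unitaryOf P hP).comp Q).comp (unitaryOf P hP).adjoint =
    Adjointable.block A (-((CFC.sqrt (A ^ 2 - A)).comp U.adjoint)) (U.comp (CFC.sqrt (A ^ 2 - A)))
      ((U.comp (1 - A)).comp U.adjoint + Q₀)

end Basic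

/-- The function `f` on `(0,1)ᶜ = (-∞, 0] ∪ [1, ∞)` with value `1` on `[1, ∞)` and `-1` on
`(-∞, 0]`; its values on `(0,1)` play no role. -/
noncomputable def signFun (t : ℝ) : ℝ := if 1 ≤ t then 1 else -1

end HilbertCStar

open HilbertCStar

/-! The condition `0 ≤ A ^ 2 - A` keeps the spectrum of `A` out of `(0, 1)`, so `2A - 1` is
invertible. Write `l = ℓ(A)` and `j = (2A - 1)⁻¹`. Then `B = Aj` and `1 - B = (A - 1)j`.

For an idempotent `q`, the projection onto its range is `q(q + q⋆ - 1)⁻¹`. For the given block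
matrix, `q + q⋆ - 1` is diagonal, and the formula yields `p` with entries `Aj`, `ljU⋆`, `Ulj`, `U(A
- 1)jU⋆ + Q₀`. The formula serves only to find `p`. The proof verifies that `p` is self-adjoint with
`qp = p` and `pq = q`, which forces `p` to be the projection onto the range of `q` and shows that
this range is complemented (`exists_comp_proj_comp_adjoint_eq`).

The initial projection `U⋆U` commutes with `A` and fixes `l` (`commute_adjoint_comp`,
`sqrt_mul_adjoint_comp`). Hence the products `qp` and `pq` reduce to products of 2 × 2 matrices over
a commutative ring, where only `l² = A² - A` and `(2A - 1)j = 1` are needed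
(`block_comp_block_of_isPartialIsometry`, `reflect_identities`).

The off-diagonal entry contains `lj`, which changes sign with `2A - 1`, whereas `B^{1/2}(1 -
B)^{1/2} = l|j| = lj f(A)` (`sqrt_mul_sqrt_one_sub`). Since `f(A)² = 1`, replacing `U` by `U f(A)`
absorbs this sign and leaves the diagonal corner unchanged. -/

namespace HilbertCStar

/-! ### Functional calculus for `a` with `a² - a ≥ 0` -/

section CStar

theorem two_mul_sub_one_eq_cfc {R : Type*} [CStarAlgebra R] {a : R} (ha : IsSelfAdjoint a) :
    2 * a - 1 = cfc (fun t : ℝ => 2 * t - 1) a := by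
  rw [cfc_sub (fun t : ℝ => 2 * t) (fun _ => 1) a, cfc_const_mul_id (2 : ℝ) a,
    cfc_const_one ℝ a, two_smul, two_mul]

variable {R : Type*} [CStarAlgebra R] [PartialOrder R] [StarOrderedRing R] {a : R}

theorem spectrum_subset_compl_Ioo (ha : IsSelfAdjoint a) (h : 0 ≤ a ^ 2 - a) :
    spectrum ℝ a ⊆ (Set.Ioo 0 1)ᶜ := by
  have e : a ^ 2 - a = cfc (fun t : ℝ => t ^ 2 - t) a := by
    rw [cfc_sub (fun t : ℝ => t ^ 2) (fun t => t) a, cfc_pow_id (R := ℝ) a 2, cfc_id' ℝ a]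
  rw [e, cfc_nonneg_iff _ a] at h
  rintro t ht ⟨h0, h1⟩
  nlinarith [h t ht]

theorem le_or_le_of_mem_spectrum (ha : IsSelfAdjoint a) (h : 0 ≤ a ^ 2 - a) {t : ℝ}
    (ht : t ∈ spectrum ℝ a) : t ≤ 0 ∨ 1 ≤ t := by
  have := spectrum_subset_compl_Ioo ha h ht
  by_contra! hc
  exact this hc

theorem two_mul_sub_one_ne_zero (ha : IsSelfAdjoint a) (h : 0 ≤ a ^ 2 - a) {t : ℝ}
    (ht : t ∈ spectrum ℝ a) : 2 * t - 1 ≠ 0 := by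
  rcases le_or_le_of_mem_spectrum ha h ht with h | h <;> intro h' <;> linarith

/-- The domain is a union of two closed half-lines, on each of which the function is constant. -/
theorem continuousOn_signFun : ContinuousOn signFun (Set.Ioo 0 1)ᶜ := by
  have h1 : ContinuousOn signFun (Set.Ici 1) :=
    (continuousOn_const (c := (1 : ℝ))).congr fun t ht => if_pos ht
  have h0 : ContinuousOn signFun (Set.Iic 0) :=
    (continuousOn_const (c := (-1 : ℝ))).congr fun t ht =>
      if_neg (not_le.mpr (lt_of_le_of_lt (Set.mem_Iic.mp ht) one_pos))
  refine (h0.union_of_isClosed h1 isClosed_Iic isClosed_Ici).mono fun t ht => ?_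
  by_contra! hc
  simp at hc
  exact ht hc

theorem isUnit_two_mul_sub_one (ha : IsSelfAdjoint a) (h : 0 ≤ a ^ 2 - a) :
    IsUnit (2 * a - 1) := by
  rw [two_mul_sub_one_eq_cfc ha, isUnit_cfc_iff _ a]
  exact fun t ht => two_mul_sub_one_ne_zero ha h ht

theorem continuousOn_inv_two_mul_sub_one (ha : IsSelfAdjoint a) (h : 0 ≤ a ^ 2 - a) :
    ContinuousOn (fun t : ℝ => (2 * t - 1)⁻¹) (spectrum ℝ a) :=
  ContinuousOn.inv₀ (by fun_prop) fun _ ht => two_mul_sub_one_ne_zero ha h ht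

/-- Turns relations between `a`, its square root `ℓ(a)` and the inverse into scalar identities on
the spectrum. -/
theorem inverse_eq_cfc (ha : IsSelfAdjoint a) (h : 0 ≤ a ^ 2 - a) :
    Ring.inverse (2 * a - 1) = cfc (fun t : ℝ => (2 * t - 1)⁻¹) a := by
  have hc := continuousOn_inv_two_mul_sub_one ha h
  refine (isUnit_two_mul_sub_one ha h).mul_right_injective ?_
  dsimp only
  rw [Ring.mul_inverse_cancel _ (isUnit_two_mul_sub_one ha h), two_mul_sub_one_eq_cfc ha,
    ← cfc_mul _ _ a, ← cfc_const_one ℝ a]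
  exact cfc_congr fun t ht => (mul_inv_cancel₀ (two_mul_sub_one_ne_zero ha h ht)).symm

theorem mul_inverse_eq_cfc (ha : IsSelfAdjoint a) (h : 0 ≤ a ^ 2 - a) :
    a * Ring.inverse (2 * a - 1) = cfc (fun t : ℝ => t * (2 * t - 1)⁻¹) a := by
  have hc := continuousOn_inv_two_mul_sub_one ha h
  rw [inverse_eq_cfc ha h, cfc_mul (fun t : ℝ => t) _ a, cfc_id' ℝ a]

theorem one_sub_mul_inverse (ha : IsSelfAdjoint a) (h : 0 ≤ a ^ 2 - a) :
    1 - a * Ring.inverse (2 * a - 1) = (a - 1) * Ring.inverse (2 * a - 1) := by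
  have e := Ring.mul_inverse_cancel _ (isUnit_two_mul_sub_one ha h)
  calc 1 - a * Ring.inverse (2 * a - 1)
      = (2 * a - 1) * Ring.inverse (2 * a - 1) - a * Ring.inverse (2 * a - 1) := by rw [e]
    _ = _ := by noncomm_ring

theorem one_sub_mul_inverse_eq_cfc (ha : IsSelfAdjoint a) (h : 0 ≤ a ^ 2 - a) :
    1 - a * Ring.inverse (2 * a - 1) = cfc (fun t : ℝ => (t - 1) * (2 * t - 1)⁻¹) a := by
  have hc := continuousOn_inv_two_mul_sub_one ha h
  rw [one_sub_mul_inverse ha h, inverse_eq_cfc ha h, cfc_mul (fun t : ℝ => t - 1) _ a,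
    cfc_sub (fun t : ℝ => t) (fun _ => 1) a, cfc_id' ℝ a, cfc_const_one ℝ a]

theorem mul_inverse_two_mul_sub_one_nonneg {t : ℝ} (ht : t ≤ 0 ∨ 1 ≤ t) :
    0 ≤ t * (2 * t - 1)⁻¹ := by
  rcases ht with ht | ht
  · exact mul_nonneg_of_nonpos_of_nonpos ht (inv_nonpos.mpr (by linarith))
  · exact mul_nonneg (by linarith) (inv_nonneg.mpr (by linarith))

theorem sub_one_mul_inverse_two_mul_sub_one_nonneg {t : ℝ} (ht : t ≤ 0 ∨ 1 ≤ t) :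
    0 ≤ (t - 1) * (2 * t - 1)⁻¹ := by
  rcases ht with ht | ht
  · exact mul_nonneg_of_nonpos_of_nonpos (by linarith) (inv_nonpos.mpr (by linarith))
  · exact mul_nonneg (by linarith) (inv_nonneg.mpr (by linarith))

theorem mul_inverse_nonneg (ha : IsSelfAdjoint a) (h : 0 ≤ a ^ 2 - a) :
    0 ≤ a * Ring.inverse (2 * a - 1) := by
  rw [mul_inverse_eq_cfc ha h]
  exact cfc_nonneg fun t ht =>
    mul_inverse_two_mul_sub_one_nonneg (le_or_le_of_mem_spectrum ha h ht)

theorem mul_inverse_le_one (ha : IsSelfAdjoint a) (h : 0 ≤ a ^ 2 - a) :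
    a * Ring.inverse (2 * a - 1) ≤ 1 := by
  rw [← sub_nonneg, one_sub_mul_inverse_eq_cfc ha h]
  exact cfc_nonneg fun t ht =>
    sub_one_mul_inverse_two_mul_sub_one_nonneg (le_or_le_of_mem_spectrum ha h ht)

/-- On nonnegative real functions, the square root commutes with the functional calculus. -/
theorem sqrt_cfc_eq (a : R) {f : ℝ → ℝ} (hf : ContinuousOn f (spectrum ℝ a))
    (h0 : ∀ t ∈ spectrum ℝ a, 0 ≤ f t) :
    CFC.sqrt (cfc f a) = cfc (fun t => √(f t)) a := by
  have hc : ContinuousOn (fun t => √(f t)) (spectrum ℝ a) := hf.sqrt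
  refine CFC.sqrt_unique ?_ (cfc_nonneg fun t _ => Real.sqrt_nonneg _)
  rw [← cfc_mul _ _ a]
  exact cfc_congr fun t ht => Real.mul_self_sqrt (h0 t ht)

theorem sqrt_sq_sub_eq_cfc (ha : IsSelfAdjoint a) (h : 0 ≤ a ^ 2 - a) :
    CFC.sqrt (a ^ 2 - a) = cfc (fun t : ℝ => √(t ^ 2 - t)) a := by
  have e : a ^ 2 - a = cfc (fun t : ℝ => t ^ 2 - t) a := by
    rw [cfc_sub (fun t : ℝ => t ^ 2) (fun t => t) a, cfc_pow_id (R := ℝ) a 2, cfc_id' ℝ a]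
  rw [e]
  refine sqrt_cfc_eq a (by fun_prop) fun t ht => ?_
  rcases le_or_le_of_mem_spectrum ha h ht with ht | ht <;> nlinarith

/-- This is where `f` enters. For `t` in the spectrum the product of the two roots is `√(t² - t) ·
|2t - 1|⁻¹`, and `|2t - 1|⁻¹ = (2t - 1)⁻¹ f(t)` because `2t - 1` is positive for `t ≥ 1` and
negative for `t ≤ 0`. -/
theorem sqrt_mul_sqrt_one_sub (ha : IsSelfAdjoint a) (h : 0 ≤ a ^ 2 - a) :
    CFC.sqrt (a * Ring.inverse (2 * a - 1)) * CFC.sqrt (1 - a * Ring.inverse (2 * a - 1)) =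
      CFC.sqrt (a ^ 2 - a) * Ring.inverse (2 * a - 1) * cfc signFun a := by
  have hc := continuousOn_inv_two_mul_sub_one ha h
  have hs := continuousOn_signFun.mono (spectrum_subset_compl_Ioo ha h)
  rw [one_sub_mul_inverse_eq_cfc ha h, mul_inverse_eq_cfc ha h, sqrt_sq_sub_eq_cfc ha h,
    inverse_eq_cfc ha h,
    sqrt_cfc_eq a (by fun_prop) fun t ht =>
      mul_inverse_two_mul_sub_one_nonneg (le_or_le_of_mem_spectrum ha h ht),
    sqrt_cfc_eq a (by fun_prop) fun t ht =>
      sub_one_mul_inverse_two_mul_sub_one_nonneg (le_or_le_of_mem_spectrum ha h ht),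
    ← cfc_mul _ _ a (by fun_prop) (by fun_prop), ← cfc_mul _ _ a (by fun_prop) hc,
    ← cfc_mul _ _ a (by fun_prop) hs]
  refine cfc_congr fun t ht => ?_
  have ht' := le_or_le_of_mem_spectrum ha h ht
  rw [← Real.sqrt_mul (mul_inverse_two_mul_sub_one_nonneg ht'),
    show t * (2 * t - 1)⁻¹ * ((t - 1) * (2 * t - 1)⁻¹) = (t ^ 2 - t) * ((2 * t - 1)⁻¹) ^ 2 by ring,
    Real.sqrt_mul' _ (sq_nonneg _), Real.sqrt_sq_eq_abs, mul_assoc]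
  congr 1
  rcases ht' with ht' | ht'
  · rw [abs_of_nonpos (inv_nonpos.mpr (by linarith)), signFun, if_neg (by linarith), mul_neg_one]
  · rw [abs_of_nonneg (inv_nonneg.mpr (by linarith)), signFun, if_pos ht', mul_one]

theorem cfc_signFun_mul_self (ha : IsSelfAdjoint a) (h : 0 ≤ a ^ 2 - a) :
    cfc signFun a * cfc signFun a = 1 := by
  have hs := continuousOn_signFun.mono (spectrum_subset_compl_Ioo ha h)
  rw [← cfc_mul _ _ a, ← cfc_const_one ℝ a]
  refine cfc_congr fun t _ => ?_
  dsimp only [signFun]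
  split_ifs <;> norm_num

end CStar

/-! ### Block matrix products along a partial isometry -/

section Block

variable {𝔄 E F G K : Type*} [NonUnitalCStarAlgebra 𝔄] [PartialOrder 𝔄] [StarOrderedRing 𝔄]
variable [NormedAddCommGroup E] [NormedSpace ℂ E] [SMul 𝔄 E] [CStarModule 𝔄 E]
variable [NormedAddCommGroup F] [NormedSpace ℂ F] [SMul 𝔄 F] [CStarModule 𝔄 F]
variable [NormedAddCommGroup G] [NormedSpace ℂ G] [SMul 𝔄 G] [CStarModule 𝔄 G]
variable [NormedAddCommGroup K] [NormedSpace ℂ K] [SMul 𝔄 K] [CStarModule 𝔄 K]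

namespace Adjointable

theorem comp_assoc (R : Adjointable 𝔄 G K) (S : Adjointable 𝔄 F G) (T : Adjointable 𝔄 E F) :
    (R.comp S).comp T = R.comp (S.comp T) := rfl

theorem comp_add (R : Adjointable 𝔄 F G) (S T : Adjointable 𝔄 E F) :
    R.comp (S + T) = R.comp S + R.comp T := ext fun x => by simp

theorem add_comp (R S : Adjointable 𝔄 F G) (T : Adjointable 𝔄 E F) :
    (R + S).comp T = R.comp T + S.comp T := ext fun x => by simp

theorem neg_comp (S : Adjointable 𝔄 F G) (T : Adjointable 𝔄 E F) :
    (-S).comp T = -S.comp T := ext fun x => by simp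

theorem comp_zero (S : Adjointable 𝔄 F G) : S.comp (0 : Adjointable 𝔄 E F) = 0 :=
  ext fun x => by simp

theorem zero_comp (T : Adjointable 𝔄 E F) : (0 : Adjointable 𝔄 F G).comp T = 0 :=
  ext fun x => by simp

theorem adjoint_comp (S : Adjointable 𝔄 F G) (T : Adjointable 𝔄 E F) :
    (S.comp T).adjoint = T.adjoint.comp S.adjoint := rfl

theorem adjoint_adjoint (T : Adjointable 𝔄 E F) : T.adjoint.adjoint = T := rfl

theorem adjoint_add (S T : Adjointable 𝔄 E F) : (S + T).adjoint = S.adjoint + T.adjoint := rfl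

theorem adjoint_zero : (0 : Adjointable 𝔄 E F).adjoint = 0 := rfl

theorem adjoint_block (a : Adjointable 𝔄 E E) (b : Adjointable 𝔄 F E) (c : Adjointable 𝔄 E F)
    (d : Adjointable 𝔄 F F) :
    (block a b c d).adjoint = block a.adjoint c.adjoint b.adjoint d.adjoint := rfl

theorem block_comp_block (a a' : Adjointable 𝔄 E E) (b b' : Adjointable 𝔄 F E)
    (c c' : Adjointable 𝔄 E F) (d d' : Adjointable 𝔄 F F) :
    (block a b c d).comp (block a' b' c' d') =
      block (a.comp a' + b.comp c') (a.comp b' + b.comp d')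
        (c.comp a' + d.comp c') (c.comp b' + d.comp d') := by
  ext x
  rw [comp_apply, block_apply, block_apply, block_apply]
  congr 1
  ext <;> simp <;> abel

section PartialIsometry

variable {U : Adjointable 𝔄 E F} {Q₀ : Adjointable 𝔄 F F}

theorem IsPartialIsometry.adjoint_comp_comp_adjoint (hU : U.IsPartialIsometry) :
    (U.adjoint.comp U).comp U.adjoint = U.adjoint :=
  congrArg Adjointable.adjoint hU

theorem comp_eq_zero_of_adjoint_comp (hQ₀ : IsStarProjection Q₀) (h : U.adjoint.comp Q₀ = 0) :
    Q₀.comp U = 0 := by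
  have hQ : Q₀.adjoint = Q₀ := hQ₀.isSelfAdjoint
  have h' := congrArg Adjointable.adjoint h
  rwa [adjoint_comp, adjoint_adjoint, hQ, adjoint_zero] at h'

/-- Products of block operators whose entries are carried from `E` to `F` by `U`. -/
theorem block_comp_block_of_isPartialIsometry (hU : U.IsPartialIsometry)
    (hQ₀ : IsStarProjection Q₀) (h : U.adjoint.comp Q₀ = 0) {a m n c a' m' n' c' : Adjointable 𝔄 E E}
    (hm : m * U.adjoint.comp U = m) (hn' : U.adjoint.comp U * n' = n')
    (hc : c * U.adjoint.comp U = U.adjoint.comp U * c) :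
    (block a (m.comp U.adjoint) (U.comp n) ((U.comp c).comp U.adjoint + Q₀)).comp
      (block a' (m'.comp U.adjoint) (U.comp n') ((U.comp c').comp U.adjoint + Q₀)) =
    block (a * a' + m * n') ((a * m' + m * c').comp U.adjoint) (U.comp (n * a' + c * n'))
      ((U.comp (n * m' + c * c')).comp U.adjoint + Q₀) := by
  have h' := comp_eq_zero_of_adjoint_comp hQ₀ h
  have hUe : U.comp (U.adjoint.comp U) = U := hU
  have hQQ : Q₀.comp Q₀ = Q₀ := hQ₀.isIdempotentElem
  -- Composition is associative by definition, so once `U⋆U` is inserted on the right the two sides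
  -- agree by `rfl`. The next two products work the same way.
  have hmn : (m.comp U.adjoint).comp (U.comp n') = m * n' := by
    conv_rhs => rw [← hn']
    rfl
  have hmc : (m.comp U.adjoint).comp ((U.comp c').comp U.adjoint) = (m * c').comp U.adjoint := by
    conv_rhs => rw [← hm]
    rfl
  have hcn : ((U.comp c).comp U.adjoint).comp (U.comp n') = U.comp (c * n') := by
    conv_rhs => rw [← hn']
    rfl
  -- Here no outer factor absorbs the inner `U⋆U`; it is moved past `c` to the left, where `U U⋆ U =
  -- U` removes it.
  have hcc : ((U.comp c).comp U.adjoint).comp ((U.comp c').comp U.adjoint) =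
      (U.comp (c * c')).comp U.adjoint := by
    calc _ = (U.comp (c * U.adjoint.comp U)).comp (c'.comp U.adjoint) := rfl
      _ = ((U.comp (U.adjoint.comp U)).comp c).comp (c'.comp U.adjoint) := by rw [hc]; rfl
      _ = _ := by rw [hUe]; rfl
  rw [block_comp_block]
  congr 1
  · rw [hmn]; rfl
  · rw [comp_add, hmc, comp_assoc m, h, comp_zero, add_zero, add_comp]; rfl
  · rw [add_comp, hcn, ← comp_assoc Q₀, h', zero_comp, add_zero, comp_add]; rfl
  · rw [comp_add, add_comp, add_comp, hcc, comp_assoc, comp_assoc _ _ Q₀, h, comp_zero, hQQ,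
      ← comp_assoc Q₀, ← comp_assoc Q₀, h', zero_comp, zero_comp, add_zero, zero_add, comp_add,
      add_comp, add_assoc]
    rfl

end PartialIsometry

end Adjointable

end Block

/-! ### Commutative 2 × 2 matrix identities -/

section RingIdentities

variable {R : Type*} [Ring R] {a l j : R}

/-- The entrywise form of `q * p = p` and `p * q = q` for the `2 × 2` matrices
`q = [[a, -l], [l, 1 - a]]` and `p = [[a * j, l * j], [l * j, 1 - a * j]]`. -/
theorem reflect_identities (hal : a * l = l * a) (haj : a * j = j * a) (hlj : l * j = j * l)
    (hl : l * l = a ^ 2 - a) (hj : (2 * a - 1) * j = 1) :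
    (a * (a * j) + -l * (l * j) = a * j ∧ a * (l * j) + -l * ((a - 1) * j) = l * j ∧
      l * (a * j) + (1 - a) * (l * j) = l * j ∧
      l * (l * j) + (1 - a) * ((a - 1) * j) = (a - 1) * j) ∧
    (a * j * a + l * j * l = a ∧ a * j * -l + l * j * (1 - a) = -l ∧
      l * j * a + (a - 1) * j * l = l ∧ l * j * -l + (a - 1) * j * (1 - a) = 1 - a) := by
  -- The elements commute pairwise, so they generate a commutative subring, in which `ring` and
  -- `linear_combination` apply.
  let S := Subring.closure {a, l, j}
  have hcomm : IsMulCommutative S := Subring.isMulCommutative_closure (by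
    rintro x (rfl | rfl | rfl) y (rfl | rfl | rfl) <;> first | rfl | assumption | (symm; assumption))
  let : CommRing S := { (inferInstance : Ring S) with mul_comm := hcomm.is_comm.comm }
  let a' : S := ⟨a, Subring.subset_closure (by simp)⟩
  let l' : S := ⟨l, Subring.subset_closure (by simp)⟩
  let j' : S := ⟨j, Subring.subset_closure (by simp)⟩
  have hl' : l' * l' = a' ^ 2 - a' := Subtype.ext hl
  have hj' : (2 * a' - 1) * j' = 1 := Subtype.ext hj
  have key : (a' * (a' * j') + -l' * (l' * j') = a' * j' ∧
      a' * (l' * j') + -l' * ((a' - 1) * j') = l' * j' ∧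
      l' * (a' * j') + (1 - a') * (l' * j') = l' * j' ∧
      l' * (l' * j') + (1 - a') * ((a' - 1) * j') = (a' - 1) * j') ∧
    (a' * j' * a' + l' * j' * l' = a' ∧ a' * j' * -l' + l' * j' * (1 - a') = -l' ∧
      l' * j' * a' + (a' - 1) * j' * l' = l' ∧
      l' * j' * -l' + (a' - 1) * j' * (1 - a') = 1 - a') := by
    refine ⟨⟨?_, by ring, by ring, ?_⟩, ?_, ?_, ?_, ?_⟩
    · linear_combination -j' * hl'
    · linear_combination j' * hl'
    · linear_combination a' * hj' + j' * hl'
    · linear_combination -l' * hj'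
    · linear_combination l' * hj'
    · linear_combination -j' * hl' - (a' - 1) * hj'
  obtain ⟨⟨h1, h2, h3, h4⟩, h5, h6, h7, h8⟩ := key
  have val {x y : S} (h : x = y) : (x : R) = y := congrArg _ h
  exact ⟨⟨val h1, val h2, val h3, val h4⟩, val h5, val h6, val h7, val h8⟩

end RingIdentities
-- Range projections under a unitary; ranges and closures
section Transport

variable {𝔄 E K : Type*} [NonUnitalCStarAlgebra 𝔄] [PartialOrder 𝔄] [StarOrderedRing 𝔄]
variable [NormedAddCommGroup E] [NormedSpace ℂ E] [SMul 𝔄 E] [CStarModule 𝔄 E]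
variable [NormedAddCommGroup K] [NormedSpace ℂ K] [SMul 𝔄 K] [CStarModule 𝔄 K]

open Adjointable

theorem unitaryOf_adjoint_comp (P : Adjointable 𝔄 E E) (hP : IsStarProjection P) :
    (unitaryOf P hP).adjoint.comp (unitaryOf P hP) = 1 := by
  ext x
  change P x + (1 - P) x = x
  simp

theorem unitaryOf_comp_adjoint (P : Adjointable 𝔄 E E) (hP : IsStarProjection P) :
    (unitaryOf P hP).comp (unitaryOf P hP).adjoint = 1 := by
  ext x
  have h1 : P (x.1 : E) = x.1 := by
    obtain ⟨w, hw⟩ := x.1.2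
    rw [← hw]
    exact congrArg (fun T : Adjointable 𝔄 E E => T w) hP.isIdempotentElem
  have h2 : P (x.2 : E) = 0 := x.2.2
  refine Prod.ext (Subtype.ext ?_) (Subtype.ext ?_)
  · change P ((x.1 : E) + x.2) = x.1
    rw [map_add, h1, h2, add_zero]
  · change (x.1 : E) + x.2 - P ((x.1 : E) + x.2) = x.2
    rw [map_add, h1, h2, add_zero, add_sub_cancel_left]

/-- If `p` is self-adjoint and has the range of the idempotent `V Q V⋆`, where `V` is unitary,
then `𝓡(Q)` is orthogonally complemented and `V` carries the projection onto it to `p`. -/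
theorem exists_comp_proj_comp_adjoint_eq {V : Adjointable 𝔄 E K} (hV : V.adjoint.comp V = 1)
    (hV' : V.comp V.adjoint = 1) {Q : Adjointable 𝔄 E E} (hQ : IsIdempotentElem Q)
    {p : Adjointable 𝔄 K K} (hp : p.adjoint = p)
    (hqp : ((V.comp Q).comp V.adjoint).comp p = p)
    (hpq : p.comp ((V.comp Q).comp V.adjoint) = (V.comp Q).comp V.adjoint) :
    ∃ h : (ClosedSubmod.range Q hQ).IsOrthogonallyComplemented,
      (V.comp ((ClosedSubmod.range Q hQ).proj h)).comp V.adjoint = p := by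
  -- The pullback of `p` along `V`. `QT = T` places its values in `𝓡(Q)`; `TQ = Q` with
  -- self-adjointness makes `x - Tx` orthogonal to `𝓡(Q)`. So `x = Tx + (x - Tx)` is the orthogonal
  -- decomposition, giving both the complement and the projection.
  let T : Adjointable 𝔄 E E := (V.adjoint.comp p).comp V
  have hT : T.adjoint = T := by
    change (V.adjoint.comp p.adjoint).comp V = T
    rw [hp]
  have hQT : Q.comp T = T := by
    calc Q.comp T = ((1 : Adjointable 𝔄 E E).comp Q).comp T := rfl
      _ = (V.adjoint.comp (((V.comp Q).comp V.adjoint).comp p)).comp V := by rw [← hV]; rfl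
      _ = T := by rw [hqp]
  have hTQ : T.comp Q = Q := by
    calc T.comp Q = (T.comp Q).comp (1 : Adjointable 𝔄 E E) := rfl
      _ = (V.adjoint.comp (p.comp ((V.comp Q).comp V.adjoint))).comp V := by rw [← hV]; rfl
      _ = ((V.adjoint.comp V).comp Q).comp (V.adjoint.comp V) := by rw [hpq]; rfl
      _ = Q := by rw [hV]; rfl
  have hmem : ∀ x, T x ∈ (ClosedSubmod.range Q hQ).toSubmodule := fun x =>
    ⟨T x, congrArg (fun S : Adjointable 𝔄 E E => S x) hQT⟩
  have horth : ∀ x, (ClosedSubmod.range Q hQ).IsOrthogonalTo (x - T x) := by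
    rintro x _ ⟨y, rfl⟩
    have h1 : T (Q y) = Q y := congrArg (fun S : Adjointable 𝔄 E E => S y) hTQ
    change ⟪x - T x, Q y⟫_𝔄 = 0
    rw [CStarModule.inner_sub_left, T.inner_left, hT, h1, sub_self]
  have h : (ClosedSubmod.range Q hQ).IsOrthogonallyComplemented := fun x =>
    ⟨T x, hmem x, x - T x, horth x, by simp⟩
  refine ⟨h, ?_⟩
  have hproj : (ClosedSubmod.range Q hQ).proj h = T :=
    ext fun x => ClosedSubmod.component_eq h (hmem x) (horth x)
  calc _ = ((V.comp V.adjoint).comp p).comp (V.comp V.adjoint) := by rw [hproj]; rfl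
    _ = p := by rw [hV']; rfl

theorem range_mul_eq_of_mul_eq_one {X u v : Adjointable 𝔄 E E} (h : u * v = 1) :
    Set.range (X * u).toCLM = Set.range X.toCLM := by
  apply subset_antisymm
  · rintro _ ⟨x, rfl⟩
    exact ⟨u x, rfl⟩
  · rintro _ ⟨x, rfl⟩
    refine ⟨v x, ?_⟩
    calc (X * u) (v x) = (X * (u * v)) x := rfl
      _ = X x := by rw [h, mul_one]

/-- A continuous involution is a homeomorphism. -/
theorem image_closure_of_mul_self {S : Adjointable 𝔄 E E} (h : S * S = 1) (X : Set E) :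
    S.toCLM '' closure X = closure (S.toCLM '' X) := by
  have hS : ∀ x, S (S x) = x := fun x => congrArg (fun T : Adjointable 𝔄 E E => T x) h
  refine (image_closure_subset_closure_image S.toCLM.continuous).antisymm fun x hx => ?_
  refine ⟨S x, ?_, hS x⟩
  have h1 := image_closure_subset_closure_image S.toCLM.continuous ⟨x, hx, rfl⟩
  rwa [← Set.image_comp, show S.toCLM ∘ S.toCLM = id from funext hS, Set.image_id] at h1

end Transport

/-! ### The initial projection `U⋆U` of the canonical representation -/

section Canonical

variable {𝔄 E F : Type*} [NonUnitalCStarAlgebra 𝔄] [PartialOrder 𝔄] [StarOrderedRing 𝔄]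
variable [NormedAddCommGroup E] [NormedSpace ℂ E] [SMul 𝔄 E] [CStarModule 𝔄 E]
variable [NormedAddCommGroup F] [NormedSpace ℂ F] [SMul 𝔄 F] [CStarModule 𝔄 F]
variable {A : Adjointable 𝔄 E E} {U : Adjointable 𝔄 E F}

open Adjointable

theorem isSelfAdjoint_adjoint_comp (U : Adjointable 𝔄 E F) :
    IsSelfAdjoint (U.adjoint.comp U) := rfl

theorem adjoint_comp_mul_eq (hU : U.IsPartialIsometry) {X : Adjointable 𝔄 E E}
    (hX : Set.range X.toCLM ⊆ Set.range U.adjoint) : U.adjoint.comp U * X = X := by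
  ext x
  obtain ⟨y, hy⟩ := hX ⟨x, rfl⟩
  change (U.adjoint.comp U) (X x) = X x
  rw [← hy]
  exact congrArg (fun T : Adjointable 𝔄 F E => T y) hU.adjoint_comp_comp_adjoint

/-- The range of the projection `e = U⋆U` is the closure of the range of `A² - A`, which `A` leaves
invariant since it commutes with `A² - A`. Thus `eAe = Ae`, and the adjoint of this identity gives
`eA = eAe = Ae`. -/
theorem commute_adjoint_comp (hA : IsSelfAdjoint A) (hU : U.IsPartialIsometry)
    (hr : Set.range U.adjoint = closure (Set.range (A ^ 2 - A).toCLM)) :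
    Commute A (U.adjoint.comp U) := by
  set e := U.adjoint.comp U with he
  have h1 : e * (A * e) = A * e := by
    refine adjoint_comp_mul_eq hU ?_
    rintro _ ⟨x, rfl⟩
    rw [hr]
    have hx : e x ∈ closure (Set.range (A ^ 2 - A).toCLM) := hr ▸ ⟨U x, rfl⟩
    refine map_mem_closure (f := A.toCLM) A.toCLM.continuous hx ?_
    rintro _ ⟨y, rfl⟩
    refine ⟨A y, ?_⟩
    change ((A ^ 2 - A) * A) y = (A * (A ^ 2 - A)) y
    congr 2
    noncomm_ring
  have h2 := congrArg star h1
  rw [star_mul, star_mul, hA.star_eq, (isSelfAdjoint_adjoint_comp U).star_eq, ← he, mul_assoc,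
    h1] at h2
  exact h2

/-- With `e = U⋆U` and `l` the square root, `l(1 - e)` vanishes by the C⋆-identity: its square `(1 -
e)l²(1 - e)` is zero because `e` fixes `l² = A² - A`. No description of the range of `l` is
required. -/
theorem sqrt_mul_adjoint_comp [CompleteSpace E] (hU : U.IsPartialIsometry)
    (hA0 : 0 ≤ A ^ 2 - A)
    (hr : Set.range U.adjoint = closure (Set.range (A ^ 2 - A).toCLM)) :
    CFC.sqrt (A ^ 2 - A) * U.adjoint.comp U = CFC.sqrt (A ^ 2 - A) := by
  set e := U.adjoint.comp U with he
  have h1 : e * (A ^ 2 - A) = A ^ 2 - A :=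
    adjoint_comp_mul_eq hU (hr ▸ subset_closure)
  have hl : star (CFC.sqrt (A ^ 2 - A)) = CFC.sqrt (A ^ 2 - A) :=
    (CFC.sqrt_nonneg (A ^ 2 - A)).isSelfAdjoint
  have hes : star e = e := isSelfAdjoint_adjoint_comp U
  rw [eq_comm, ← sub_eq_zero, ← CStarRing.star_mul_self_eq_zero_iff, star_sub, star_mul, hes, hl]
  calc _ = (1 - e) * (CFC.sqrt (A ^ 2 - A) * CFC.sqrt (A ^ 2 - A)) * (1 - e) := by noncomm_ring
    _ = 0 := by rw [CFC.sqrt_mul_sqrt_self (A ^ 2 - A) hA0, sub_mul, one_mul, h1, sub_self, zero_mul]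

end Canonical

end HilbertCStar

/-! ### The projection onto the range of `Q` -/

theorem mainTheorem3 {𝔄 H : Type*} [NonUnitalCStarAlgebra 𝔄] [PartialOrder 𝔄] [StarOrderedRing 𝔄]
    [NormedAddCommGroup H] [NormedSpace ℂ H] [SMul 𝔄 H] [CStarModule 𝔄 H] [CompleteSpace H]
    (P Q : Adjointable 𝔄 H H) (hPQ : IsHarmonious P Q) (hP0 : P ≠ 0) (hP1 : P ≠ 1)
    (A : Adjointable 𝔄 (ClosedSubmod.range P hPQ.isStarProjection.isIdempotentElem)
      (ClosedSubmod.range P hPQ.isStarProjection.isIdempotentElem))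
    (U : Adjointable 𝔄 (ClosedSubmod.range P hPQ.isStarProjection.isIdempotentElem)
      (ClosedSubmod.ker P))
    (Q₀ : Adjointable 𝔄 (ClosedSubmod.ker P) (ClosedSubmod.ker P))
    (hcan : IsCanonicalRep P hPQ.isStarProjection Q A U Q₀) :
    IsUnit (2 * A - 1) ∧ spectrum ℝ A ⊆ (Set.Ioo 0 1)ᶜ ∧
    ∃ hQ : (ClosedSubmod.range Q hPQ.isIdempotentElem).IsOrthogonallyComplemented,
    ∃ (B : Adjointable 𝔄 (ClosedSubmod.range P hPQ.isStarProjection.isIdempotentElem)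
        (ClosedSubmod.range P hPQ.isStarProjection.isIdempotentElem))
      (U₁ : Adjointable 𝔄 (ClosedSubmod.range P hPQ.isStarProjection.isIdempotentElem)
        (ClosedSubmod.ker P)),
      B = A * Ring.inverse (2 * A - 1) ∧
      U₁ = U.comp (cfc signFun A) ∧
      0 ≤ B ∧ ‖B‖ ≤ 1 ∧
      U₁.IsPartialIsometry ∧
      Set.range U₁.adjoint = closure (Set.range (B * (1 - B)).toCLM) ∧
      U₁.adjoint.comp Q₀ = 0 ∧
      ((unitaryOf P hPQ.isStarProjection).comp
          ((ClosedSubmod.range Q hPQ.isIdempotentElem).proj hQ)).comp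
          (unitaryOf P hPQ.isStarProjection).adjoint =
        Adjointable.block
          B
          ((CFC.sqrt B * CFC.sqrt (1 - B)).comp U₁.adjoint)
          (U₁.comp (CFC.sqrt B * CFC.sqrt (1 - B)))
          ((U₁.comp (1 - B)).comp U₁.adjoint + Q₀) := by
  have hA := hcan.isSelfAdjoint
  have hA0 := hcan.nonneg
  have hU := hcan.isPartialIsometry
  have hUQ := hcan.adjoint_comp
  have hr := hcan.range_adjoint
  have hunit := isUnit_two_mul_sub_one hA hA0
  have hsqrt := sqrt_mul_sqrt_one_sub hA hA0
  have hB1 := one_sub_mul_inverse hA hA0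
  have hBnn := mul_inverse_nonneg hA hA0
  have hBle := mul_inverse_le_one hA hA0
  have hSS := cfc_signFun_mul_self hA hA0
  have hle := sqrt_mul_adjoint_comp hU hA0 hr
  have hAe := commute_adjoint_comp hA hU hr
  have hll := CFC.sqrt_mul_sqrt_self (A ^ 2 - A) hA0
  have hj := Ring.mul_inverse_cancel _ hunit
  have hj' := Ring.inverse_mul_cancel _ hunit
  have hJ := inverse_eq_cfc hA hA0
  have hL := sqrt_sq_sub_eq_cfc hA hA0
  have hJs : IsSelfAdjoint (Ring.inverse (2 * A - 1)) := hJ ▸ cfc_predicate _ A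
  have hls : IsSelfAdjoint (CFC.sqrt (A ^ 2 - A)) := hL ▸ cfc_predicate _ A
  have hSs : IsSelfAdjoint (cfc signFun A) := cfc_predicate _ A
  have hAJ : Commute A (Ring.inverse (2 * A - 1)) :=
    hJ ▸ (hA.commute_cfc (Commute.refl A) _).symm
  have hAl : Commute A (CFC.sqrt (A ^ 2 - A)) := hL ▸ (hA.commute_cfc (Commute.refl A) _).symm
  have hAS : Commute A (cfc signFun A) := (hA.commute_cfc (Commute.refl A) _).symm
  have hlJ : Commute (CFC.sqrt (A ^ 2 - A)) (Ring.inverse (2 * A - 1)) :=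
    hL ▸ hA.commute_cfc hAJ _
  have hlS : Commute (CFC.sqrt (A ^ 2 - A)) (cfc signFun A) := hL ▸ hA.commute_cfc hAS _
  have hJS : Commute (Ring.inverse (2 * A - 1)) (cfc signFun A) := hJ ▸ hA.commute_cfc hAS _
  have hJe : Commute (Ring.inverse (2 * A - 1)) (U.adjoint.comp U) := hJ ▸ hA.commute_cfc hAe _
  have hel : U.adjoint.comp U * CFC.sqrt (A ^ 2 - A) = CFC.sqrt (A ^ 2 - A) := by
    have h := congrArg star hle
    rwa [star_mul, hls.star_eq, (isSelfAdjoint_adjoint_comp U).star_eq] at h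
  refine ⟨hunit, spectrum_subset_compl_Ioo hA hA0, ?_⟩
  have hblock := hcan.block_eq
  -- From here on only the algebraic relations collected above matter, not the origin of the three
  -- operators in the functional calculus.
  generalize CFC.sqrt (A ^ 2 - A) = l at *
  generalize Ring.inverse (2 * A - 1) = J at *
  generalize cfc signFun A = S at *
  clear hJ hL
  have hlJe : l * J * U.adjoint.comp U = l * J := by
    rw [mul_assoc, hJe.eq, ← mul_assoc, hle]
  have hS' : S.adjoint = S := hSs
  have hU1 : (U.comp S).adjoint = S.comp U.adjoint := by
    rw [Adjointable.adjoint_comp, hS']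
  have hSX {X : Adjointable 𝔄 _ _} (hX : Commute X S) : S * (X * S) = X := by
    rw [hX.eq, ← mul_assoc, hSS, one_mul]
  obtain ⟨⟨i1, i2, i3, i4⟩, i5, i6, i7, i8⟩ :=
    reflect_identities hAl.eq hAJ.eq hlJ.eq hll hj
  set q := Adjointable.block A (-(l.comp U.adjoint)) (U.comp l) ((U.comp (1 - A)).comp U.adjoint + Q₀)
    with hq
  -- The value of `q(q + q⋆ - 1)⁻¹`, written with `J = (2A - 1)⁻¹`.
  set p := Adjointable.block (A * J) ((l * J).comp U.adjoint) (U.comp (l * J))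
    ((U.comp ((A - 1) * J)).comp U.adjoint + Q₀) with hp
  have hq' : q = Adjointable.block A ((-l).comp U.adjoint) (U.comp l)
      ((U.comp (1 - A)).comp U.adjoint + Q₀) := by rw [hq, Adjointable.neg_comp]
  have hqp : q.comp p = p := by
    rw [hq', hp, Adjointable.block_comp_block_of_isPartialIsometry hU hcan.isStarProjection hUQ
      (by rw [neg_mul, hle]) (by rw [← mul_assoc, hel])
      ((Commute.one_left _).sub_left hAe).eq, i1, i2, i3, i4]
  have hpq : p.comp q = q := by
    rw [hq', hp, Adjointable.block_comp_block_of_isPartialIsometry hU hcan.isStarProjection hUQ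
      hlJe hel ((hAe.sub_left (Commute.one_left _)).mul_left hJe).eq, i5, i6, i7, i8]
  have hps : p.adjoint = p := by
    have s1 : (A * J).adjoint = A * J := (hA.commute_iff hJs).mp hAJ
    have s2 : (l * J).adjoint = l * J := (hls.commute_iff hJs).mp hlJ
    have s3 : ((A - 1) * J).adjoint = (A - 1) * J := by
      rw [← hB1]
      exact (IsSelfAdjoint.one _).sub s1
    have s4 : Q₀.adjoint = Q₀ := hcan.isStarProjection.isSelfAdjoint
    rw [hp, Adjointable.adjoint_block]
    simp only [Adjointable.adjoint_comp, Adjointable.adjoint_add, Adjointable.adjoint_adjoint,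
      s1, s2, s3, s4, Adjointable.comp_assoc]
  rw [← hblock] at hqp hpq
  obtain ⟨hQ, hproj⟩ := exists_comp_proj_comp_adjoint_eq (unitaryOf_adjoint_comp P _)
    (unitaryOf_comp_adjoint P _) hPQ.isIdempotentElem hps hqp hpq
  refine ⟨hQ, A * J, U.comp S, rfl, rfl, hBnn, ?_, ?_, ?_, ?_, ?_⟩
  · rwa [CStarAlgebra.norm_le_one_iff_of_nonneg _ hBnn]
  · change ((U.comp S).comp (U.comp S).adjoint).comp (U.comp S) = U.comp S
    rw [hU1]
    calc _ = (U.comp (S * S)).comp ((U.adjoint.comp U).comp S) := rfl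
      _ = ((U.comp U.adjoint).comp U).comp S := by rw [hSS]; rfl
      _ = U.comp S := by rw [show (U.comp U.adjoint).comp U = U from hU]
  · have e1 : Set.range (U.comp S).adjoint.toCLM = S.toCLM '' Set.range U.adjoint := by
      rw [hU1, ← Set.range_comp]; rfl
    -- `S` commutes with `A² - A` and is surjective, being its own inverse.
    have e2 : S.toCLM '' Set.range (A ^ 2 - A).toCLM = Set.range (A ^ 2 - A).toCLM := by
      conv_rhs => rw [← range_mul_eq_of_mul_eq_one (X := A ^ 2 - A) hSS,
        ((hAS.pow_left 2).sub_left hAS).eq]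
      exact (Set.range_comp _ _).symm
    have e3 : A * J * (1 - A * J) = (A ^ 2 - A) * (J * J) := by
      calc A * J * (1 - A * J) = A * (J * (A - 1)) * J := by rw [hB1]; noncomm_ring
        _ = A * ((A - 1) * J) * J := by rw [(hAJ.sub_left (Commute.one_left J)).eq]
        _ = _ := by noncomm_ring
    -- `B(1 - B)` is `A² - A` times `J²`; a right inverse of `J²` shows that this factor does not
    -- change the range.
    have e4 : J * J * ((2 * A - 1) * (2 * A - 1)) = 1 := by
      rw [mul_assoc, ← mul_assoc J (2 * A - 1), hj', one_mul, hj']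
    rw [e1, hr, image_closure_of_mul_self hSS, e2, e3, range_mul_eq_of_mul_eq_one e4]
  · rw [hU1, Adjointable.comp_assoc, hUQ, Adjointable.comp_zero]
  -- In each entry involving `U₁`, the two factors `S` can be brought together by commutation and
  -- cancel through `S² = 1`.
  · rw [hproj, hsqrt, hB1, hU1, hp]
    congr 1
    · calc _ = (l * J * (S * S)).comp U.adjoint := by rw [hSS, mul_one]
        _ = _ := rfl
    · calc _ = U.comp (S * (l * J * S)) := by rw [hSX (hlS.mul_left hJS)]
        _ = _ := rfl
    · congr 1
      calc _ = (U.comp (S * ((A - 1) * J * S))).comp U.adjoint := by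
            rw [hSX ((hAS.sub_left (Commute.one_left _)).mul_left hJS)]
        _ = _ := rfl
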